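/- Let $B\subseteq\mathbb R$ be a nonempty open interval with coordinate $r$, equipped with the metric $g_B=\varepsilon\,dr^2$, where $\varepsilon\in\{1,-1\}$. Let $k\ge 2$ and let $(F,g_F)$ be a connected $k$-dimensional smooth pseudo-Riemannian manifold with $\mathrm{Ric}_{g_F}=\nu g_F$ for a constant $\nu\in\mathbb R$. Let $\mu\in\mathbb R\setminus\{0,1,k,\overline\mu_+,\overline\mu_-\}$, where $\overline\mu_\pm=k\mp\sqrt{k^2-k}$, let $\psi\in C^\infty(B)$ be positive, and put $v=\psi^{1-\mu}$. Equip $B\times F$ with the metric $g=\psi^{2\mu}g_B+\psi^2g_F$ (the $(\psi,\mu)$-base conformal warped product). Say that $g$ is Einstein with $\lambda\in C^\infty(B\times F)$ if $\mathrm{Ric}_g=\lambda g$. For a real constant $\lambda$ consider on $B$ the equation $$(k-1)\left(\varepsilon\,\frac{(v')^2}{(1-\mu)^2}+\frac{\lambda}{k}\,v^{\frac{2}{1-\mu}}\right)=\nu.\qquad(*)$$ 1. If $g$ is Einstein with $\lambda\in C^\infty(B\times F)$, then $\lambda$ is constant and $v$ satisfies $(*)$ on $B$ with this $\lambda$. 2.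 Conversely, if $\lambda\in\mathbb R$ and $v$ is nonconstant and satisfies $(*)$ on $B$, then $g$ is Einstein with the constant $\lambda$. 3. If $\psi$ is constant, then $g$ is Einstein with $\lambda\in C^\infty(B\times F)$ if and only if $\lambda\equiv 0$ and $\nu=0$. -/

import Mathlib

set_option maxSynthPendingDepth 3

open scoped Manifold ContDiff

noncomputable section

/-! ## Curvature of a field of bilinear forms on a vector space -/

namespace CoordGeom

variable {E : Type*} [NormedAddCommGroup E] [NormedSpace ℝ E]

/-- The Christoffel symbols of the first kind, as a trilinear map:
`koszul G z u w t = (1/2) (∂_u G(w,t) + ∂_w G(u,t) - ∂_t G(u,w))` at the point `z`. -/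
def koszul (G : E → E →L[ℝ] E →L[ℝ] ℝ) (z : E) : E →L[ℝ] E →L[ℝ] E →L[ℝ] ℝ :=
  (1 / 2 : ℝ) • (fderiv ℝ G z + (fderiv ℝ G z).flip -
    (ContinuousLinearMap.flipₗᵢ ℝ E E ℝ).toContinuousLinearEquiv.toContinuousLinearMap.comp
      (fderiv ℝ G z).flip)

theorem koszul_apply (G : E → E →L[ℝ] E →L[ℝ] ℝ) (z u w t : E) :
    koszul G z u w t =
      (1 / 2) * (fderiv ℝ G z u w t + fderiv ℝ G z w u t - fderiv ℝ G z t u w) := by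
  simp [koszul]

/-- The Christoffel symbols of the second kind: `christoffel G z u w` is the vector dual
under `G z` to the covector `koszul G z u w`. -/
def christoffel (G : E → E →L[ℝ] E →L[ℝ] ℝ) (z : E) : E →L[ℝ] E →L[ℝ] E :=
  (ContinuousLinearMap.compL ℝ E (E →L[ℝ] ℝ) E (G z).inverse).comp (koszul G z)

theorem christoffel_apply (G : E → E →L[ℝ] E →L[ℝ] ℝ) (z u w : E) :
    christoffel G z u w = (G z).inverse (koszul G z u w) := by
  simp [christoffel]

/-- For constant vector fields `u, v, w` the curvature
`R(u,v)w = ∇_u ∇_v w - ∇_v ∇_u w` at `z`, as a linear map in `u`. -/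
def curvature (G : E → E →L[ℝ] E →L[ℝ] ℝ) (z v w : E) : E →ₗ[ℝ] E where
  toFun u := fderiv ℝ (christoffel G) z u v w - fderiv ℝ (christoffel G) z v u w
    + christoffel G z u (christoffel G z v w) - christoffel G z v (christoffel G z u w)
  map_add' a b := by simp only [map_add, add_apply]; abel
  map_smul' c a := by
    simp only [map_smul, smul_apply, RingHom.id_apply, smul_add, smul_sub]

/-- The Ricci tensor `Ric(v,w) = tr (u ↦ R(u,v)w)` at `z`. -/
def ricci (G : E → E →L[ℝ] E →L[ℝ] ℝ) (z v w : E) : ℝ :=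
  LinearMap.trace ℝ E (curvature G z v w)

end CoordGeom

/-! ## Pseudo-Riemannian metrics on finite-dimensional manifolds without boundary -/

section Metric

variable {E : Type*} [NormedAddCommGroup E] [NormedSpace ℝ E]
  {H : Type*} [TopologicalSpace H] (I : ModelWithCorners ℝ E H)
  {M : Type*} [TopologicalSpace M] [ChartedSpace H M]

/-- A field of bilinear forms on the tangent spaces of `M`, written in the chart around `x₀`:
its pullback under the inverse of that chart. -/
def formInChart (g : ∀ x : M, TangentSpace I x →L[ℝ] TangentSpace I x →L[ℝ] ℝ)
    (x₀ : M) (z : E) : E →L[ℝ] E →L[ℝ] ℝ :=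
  let D : E →L[ℝ] TangentSpace I ((extChartAt I x₀).symm z) :=
    mfderiv 𝓘(ℝ, E) I (extChartAt I x₀).symm z
  ContinuousLinearMap.bilinearComp (E := E) (F := E) (G := ℝ)
    (g ((extChartAt I x₀).symm z)) D D

variable (M)

/-- A smooth pseudo-Riemannian metric. -/
structure PseudoRiemannianMetric where
  /-- the scalar product on each tangent space -/
  form : ∀ x : M, TangentSpace I x →L[ℝ] TangentSpace I x →L[ℝ] ℝ
  symm : ∀ x u w, form x u w = form x w u
  nondegenerate : ∀ x u, (∀ w, form x u w = 0) → u = 0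
  smooth : ∀ x₀ : M, ContDiffOn ℝ ∞ (formInChart I form x₀) (extChartAt I x₀).target

variable {I M}

namespace PseudoRiemannianMetric

/-- The Ricci tensor at `x`, computed in the chart around `x`, through which `TangentSpace I x`
is identified with `E`. -/
def ricci (g : PseudoRiemannianMetric I M) (x : M) (u w : TangentSpace I x) : ℝ :=
  CoordGeom.ricci (E := E) (formInChart I g.form x) (extChartAt I x x) u w

/-- The metric is Einstein with the smooth function `lam`: `Ric = lam • g`. -/
def IsEinstein (g : PseudoRiemannianMetric I M) (lam : M → ℝ) : Prop :=
  ContMDiff I 𝓘(ℝ, ℝ) ∞ lam ∧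
    ∀ (x : M) (u w : TangentSpace I x), g.ricci x u w = lam x * g.form x u w

end PseudoRiemannianMetric

end Metric

/-! ## The base `B`: an open interval with the metric `± dr²` -/

section Interval

variable (B : TopologicalSpace.Opens ℝ)

/-- The one-form `dr` at `r`, `r` being the coordinate function of `B ⊆ ℝ`. -/
def coordForm (r : B) : TangentSpace 𝓘(ℝ, ℝ) r →L[ℝ] ℝ :=
  mfderiv 𝓘(ℝ, ℝ) 𝓘(ℝ, ℝ) (fun s : B => (s : ℝ)) r

/-- The derivative `f'` with respect to the coordinate `r` of a function on `B`. -/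
def derivR {B : TopologicalSpace.Opens ℝ} (f : B → ℝ) (r : B) : ℝ :=
  (show ℝ →L[ℝ] ℝ from mfderiv 𝓘(ℝ, ℝ) 𝓘(ℝ, ℝ) f r) 1

/-- `ε dr²`, as a field of bilinear forms. -/
def intervalForm (ε : ℤˣ) (r : B) :
    TangentSpace 𝓘(ℝ, ℝ) r →L[ℝ] TangentSpace 𝓘(ℝ, ℝ) r →L[ℝ] ℝ :=
  ((ε : ℤ) : ℝ) • (coordForm B r).smulRight (coordForm B r)

theorem coe_comp_chart_symm (r₀ : B) {z : ℝ} (hz : z ∈ (extChartAt 𝓘(ℝ, ℝ) r₀).target) :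
    (((extChartAt 𝓘(ℝ, ℝ) r₀).symm z : B) : ℝ) = z :=
  (extChartAt 𝓘(ℝ, ℝ) r₀).right_inv hz

theorem eventually_mem_chart_target (r₀ : B) {z : ℝ}
    (hz : z ∈ (extChartAt 𝓘(ℝ, ℝ) r₀).target) :
    ∀ᶠ y in nhds z, y ∈ (extChartAt 𝓘(ℝ, ℝ) r₀).target :=
  (isOpen_extChartAt_target r₀).mem_nhds hz

theorem coordForm_apply (r : B) (u : ℝ) :
    (show ℝ →L[ℝ] ℝ from coordForm B r) u = u := by
  have hd : MDifferentiableAt 𝓘(ℝ, ℝ) 𝓘(ℝ, ℝ) (fun s : B => (s : ℝ)) r :=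
    (contMDiff_subtype_val (n := 1)).mdifferentiable one_ne_zero r
  have he : writtenInExtChartAt 𝓘(ℝ, ℝ) 𝓘(ℝ, ℝ) r (fun s : B => (s : ℝ)) =ᶠ[nhds
      (extChartAt 𝓘(ℝ, ℝ) r r)] id := by
    filter_upwards [eventually_mem_chart_target B r (mem_extChartAt_target r)] with y hy
    exact coe_comp_chart_symm B r hy
  have h : (show ℝ →L[ℝ] ℝ from coordForm B r) = ContinuousLinearMap.id ℝ ℝ := by
    refine hd.mfderiv.trans ?_
    rw [ModelWithCorners.range_eq_univ, fderivWithin_univ, he.fderiv_eq, fderiv_id]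
  rw [h]; rfl

theorem mfderiv_interval_chart_symm_apply (r₀ : B) {z : ℝ}
    (hz : z ∈ (extChartAt 𝓘(ℝ, ℝ) r₀).target) (u : ℝ) :
    (show ℝ →L[ℝ] ℝ from mfderiv 𝓘(ℝ, ℝ) 𝓘(ℝ, ℝ) (extChartAt 𝓘(ℝ, ℝ) r₀).symm z) u = u := by
  have hd := mdifferentiableWithinAt_extChartAt_symm (I := 𝓘(ℝ, ℝ)) hz
  rw [ModelWithCorners.range_eq_univ, mdifferentiableWithinAt_univ] at hd
  have he : writtenInExtChartAt 𝓘(ℝ, ℝ) 𝓘(ℝ, ℝ) z (extChartAt 𝓘(ℝ, ℝ) r₀).symm =ᶠ[nhds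
      (extChartAt 𝓘(ℝ, ℝ) z z)] id := by
    filter_upwards [eventually_mem_chart_target B r₀ hz] with y hy
    exact coe_comp_chart_symm B r₀ hy
  have h : (show ℝ →L[ℝ] ℝ from mfderiv 𝓘(ℝ, ℝ) 𝓘(ℝ, ℝ) (extChartAt 𝓘(ℝ, ℝ) r₀).symm z) =
      ContinuousLinearMap.id ℝ ℝ := by
    refine hd.mfderiv.trans ?_
    rw [ModelWithCorners.range_eq_univ, fderivWithin_univ, he.fderiv_eq, fderiv_id]
  rw [h]; rfl

theorem intervalForm_apply (ε : ℤˣ) (r : B) (u w : ℝ) :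
    intervalForm B ε r u w = ((ε : ℤ) : ℝ) * (u * w) := by
  have hu := coordForm_apply B r u
  have hw := coordForm_apply B r w
  exact congrArg₂ (fun a b : ℝ => ((ε : ℤ) : ℝ) * (a * b)) hu hw

theorem formInChart_intervalForm_apply (ε : ℤˣ) (r₀ : B) {z : ℝ}
    (hz : z ∈ (extChartAt 𝓘(ℝ, ℝ) r₀).target) (u w : ℝ) :
    formInChart 𝓘(ℝ, ℝ) (intervalForm B ε) r₀ z u w = ((ε : ℤ) : ℝ) * (u * w) := by
  have hu := mfderiv_interval_chart_symm_apply B r₀ hz u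
  have hw := mfderiv_interval_chart_symm_apply B r₀ hz w
  exact (intervalForm_apply B ε _ _ _).trans
    (congrArg₂ (fun a b : ℝ => ((ε : ℤ) : ℝ) * (a * b)) hu hw)

/-- The pseudo-Riemannian metric `ε dr²` on `B`, `ε = 1` or `ε = -1`. -/
def intervalMetric (ε : ℤˣ) : PseudoRiemannianMetric 𝓘(ℝ, ℝ) B where
  form := intervalForm B ε
  symm r u w := by
    refine (intervalForm_apply B ε r u w).trans
      (Eq.trans ?_ (intervalForm_apply B ε r w u).symm)
    exact congrArg (((ε : ℤ) : ℝ) * ·) (mul_comm (G := ℝ) u w)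
  nondegenerate r u hu := by
    have h : ((ε : ℤ) : ℝ) * ((show ℝ from u) * 1) = 0 :=
      (intervalForm_apply B ε r u 1).symm.trans (hu (1 : ℝ))
    rw [mul_one] at h
    exact (mul_eq_zero.mp h).resolve_left (by simp)
  smooth r₀ := by
    refine (contDiff_const (c := ((ε : ℤ) : ℝ) • ContinuousLinearMap.mul ℝ ℝ)).contDiffOn.congr
      fun z hz => ?_
    ext
    simp [formInChart_intervalForm_apply B ε r₀ hz]

end Interval

/-! ## Special base conformal warped products -/

section Product

variable {EB : Type*} [NormedAddCommGroup EB] [NormedSpace ℝ EB]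
  {HB : Type*} [TopologicalSpace HB] {IB : ModelWithCorners ℝ EB HB}
  {B : Type*} [TopologicalSpace B] [ChartedSpace HB B]
  {EF : Type*} [NormedAddCommGroup EF] [NormedSpace ℝ EF]
  {HF : Type*} [TopologicalSpace HF] {IF : ModelWithCorners ℝ EF HF}
  {F : Type*} [TopologicalSpace F] [ChartedSpace HF F]

/-- The form `(ψ∘π)^{2μ} π^* g_B + (ψ∘π)^2 σ^* g_F`, with `π`, `σ` the projections. -/
def bcwpForm (gB : PseudoRiemannianMetric IB B) (gF : PseudoRiemannianMetric IF F)
    (ψ : B → ℝ) (μ : ℝ) (p : B × F) :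
    TangentSpace (IB.prod IF) p →L[ℝ] TangentSpace (IB.prod IF) p →L[ℝ] ℝ :=
  let dπ : EB × EF →L[ℝ] EB := mfderiv (IB.prod IF) IB Prod.fst p
  let dσ : EB × EF →L[ℝ] EF := mfderiv (IB.prod IF) IF Prod.snd p
  ψ p.1 ^ (2 * μ) •
      ContinuousLinearMap.bilinearComp (E := EB) (F := EB) (G := ℝ) (gB.form p.1) dπ dπ +
    ψ p.1 ^ 2 •
      ContinuousLinearMap.bilinearComp (E := EF) (F := EF) (G := ℝ) (gF.form p.2) dσ dσ

theorem bcwpForm_apply (gB : PseudoRiemannianMetric IB B)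
    (gF : PseudoRiemannianMetric IF F) (ψ : B → ℝ) (μ : ℝ) (p : B × F)
    (u w : EB × EF) :
    bcwpForm gB gF ψ μ p u w =
      ψ p.1 ^ (2 * μ) * (show EB →L[ℝ] EB →L[ℝ] ℝ from gB.form p.1) u.1 w.1 +
        ψ p.1 ^ 2 * (show EF →L[ℝ] EF →L[ℝ] ℝ from gF.form p.2) u.2 w.2 := by
  simp only [bcwpForm, mfderiv_fst, mfderiv_snd]
  rfl

variable [IB.Boundaryless] [IsManifold IB ∞ B] [IF.Boundaryless] [IsManifold IF ∞ F]

theorem mdifferentiableAt_chart_symm (x : B) {z : EB} (hz : z ∈ (extChartAt IB x).target) :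
    MDifferentiableAt 𝓘(ℝ, EB) IB (extChartAt IB x).symm z := by
  have : IsManifold IB 1 B := IsManifold.of_le (n := ∞) (by norm_cast)
  have h := mdifferentiableWithinAt_extChartAt_symm (I := IB) hz
  rwa [IB.range_eq_univ, mdifferentiableWithinAt_univ] at h

theorem mfderiv_chart_prod_symm (x : B × F) {z : EB × EF}
    (hz : z ∈ (extChartAt (IB.prod IF) x).target) (u : EB × EF) :
    (show EB × EF →L[ℝ] EB × EF from
      mfderiv 𝓘(ℝ, EB × EF) (IB.prod IF) (extChartAt (IB.prod IF) x).symm z) u =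
     ((show EB →L[ℝ] EB from mfderiv 𝓘(ℝ, EB) IB (extChartAt IB x.1).symm z.1) u.1,
      (show EF →L[ℝ] EF from mfderiv 𝓘(ℝ, EF) IF (extChartAt IF x.2).symm z.2) u.2) := by
  rw [extChartAt_prod] at hz ⊢
  have h := mfderiv_prodMap (p := z) (mdifferentiableAt_chart_symm x.1 hz.1)
    (mdifferentiableAt_chart_symm x.2 hz.2)
  rw [modelWithCornersSelf_prod, ← chartedSpaceSelf_prod]
  exact congrArg (fun L : EB × EF →L[ℝ] EB × EF => L u) h


theorem formInChart_bcwp_apply (gB : PseudoRiemannianMetric IB B)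
    (gF : PseudoRiemannianMetric IF F) (ψ : B → ℝ) (μ : ℝ) (x : B × F) {z : EB × EF}
    (hz : z ∈ (extChartAt (IB.prod IF) x).target) (u w : EB × EF) :
    formInChart (IB.prod IF) (bcwpForm gB gF ψ μ) x z u w =
      ψ ((extChartAt IB x.1).symm z.1) ^ (2 * μ) * formInChart IB gB.form x.1 z.1 u.1 w.1 +
      ψ ((extChartAt IB x.1).symm z.1) ^ 2 * formInChart IF gF.form x.2 z.2 u.2 w.2 := by
  have hu := mfderiv_chart_prod_symm x hz u
  have hw := mfderiv_chart_prod_symm x hz w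
  refine (bcwpForm_apply gB gF ψ μ ((extChartAt (IB.prod IF) x).symm z)
    (mfderiv 𝓘(ℝ, EB × EF) (IB.prod IF) (extChartAt (IB.prod IF) x).symm z u)
    (mfderiv 𝓘(ℝ, EB × EF) (IB.prod IF) (extChartAt (IB.prod IF) x).symm z w)).trans ?_
  erw [hu, hw]
  have hs : (extChartAt (IB.prod IF) x).symm z =
      ((extChartAt IB x.1).symm z.1, (extChartAt IF x.2).symm z.2) := by
    rw [extChartAt_prod]; rfl
  rw [hs]
  rfl

theorem contDiffOn_formInChart_bcwp (gB : PseudoRiemannianMetric IB B)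
    (gF : PseudoRiemannianMetric IF F) (ψ : B → ℝ) (hψ : ContMDiff IB 𝓘(ℝ, ℝ) ∞ ψ)
    (hpos : ∀ b, 0 < ψ b) (μ : ℝ) (x : B × F) :
    ContDiffOn ℝ ∞ (formInChart (IB.prod IF) (bcwpForm gB gF ψ μ) x)
      (extChartAt (IB.prod IF) x).target := by
  have ht : (extChartAt (IB.prod IF) x).target =
      (extChartAt IB x.1).target ×ˢ (extChartAt IF x.2).target := by
    rw [extChartAt_prod]; rfl
  have m1 : Set.MapsTo Prod.fst (extChartAt (IB.prod IF) x).target (extChartAt IB x.1).target := by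
    rw [ht]; exact fun z hz => hz.1
  have m2 : Set.MapsTo Prod.snd (extChartAt (IB.prod IF) x).target (extChartAt IF x.2).target := by
    rw [ht]; exact fun z hz => hz.2
  have h0 : ContDiffOn ℝ ∞ (fun z : EB × EF => ψ ((extChartAt IB x.1).symm z.1))
      (extChartAt (IB.prod IF) x).target := by
    have := (hψ.comp_contMDiffOn (contMDiffOn_extChartAt_symm (I := IB) (n := ∞) x.1))
    exact (contMDiffOn_iff_contDiffOn.mp this).comp contDiff_fst.contDiffOn m1
  have h1 : ContDiffOn ℝ ∞ (fun z : EB × EF => formInChart IB gB.form x.1 z.1)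
      (extChartAt (IB.prod IF) x).target := (gB.smooth x.1).comp contDiff_fst.contDiffOn m1
  have h2 : ContDiffOn ℝ ∞ (fun z : EB × EF => formInChart IF gF.form x.2 z.2)
      (extChartAt (IB.prod IF) x).target := (gF.smooth x.2).comp contDiff_snd.contDiffOn m2
  let P : (EB →L[ℝ] EB →L[ℝ] ℝ) →L[ℝ] EB × EF →L[ℝ] EB × EF →L[ℝ] ℝ :=
    (((ContinuousLinearMap.compL ℝ (EB × EF) EB ℝ).flip
        (ContinuousLinearMap.fst ℝ EB EF)).postcomp (EB × EF)).comp
      ((ContinuousLinearMap.compL ℝ (EB × EF) EB (EB →L[ℝ] ℝ)).flip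
        (ContinuousLinearMap.fst ℝ EB EF))
  let Q : (EF →L[ℝ] EF →L[ℝ] ℝ) →L[ℝ] EB × EF →L[ℝ] EB × EF →L[ℝ] ℝ :=
    (((ContinuousLinearMap.compL ℝ (EB × EF) EF ℝ).flip
        (ContinuousLinearMap.snd ℝ EB EF)).postcomp (EB × EF)).comp
      ((ContinuousLinearMap.compL ℝ (EB × EF) EF (EF →L[ℝ] ℝ)).flip
        (ContinuousLinearMap.snd ℝ EB EF))
  have h3 : ContDiffOn ℝ ∞ (fun z : EB × EF =>
      (ψ ((extChartAt IB x.1).symm z.1) ^ (2 * μ)) • P (formInChart IB gB.form x.1 z.1) +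
      (ψ ((extChartAt IB x.1).symm z.1) ^ 2) • Q (formInChart IF gF.form x.2 z.2))
      (extChartAt (IB.prod IF) x).target :=
    ((h0.rpow_const_of_ne fun z _ => (hpos _).ne').smul (P.contDiff.comp_contDiffOn h1)).add
      ((h0.pow 2).smul (Q.contDiff.comp_contDiffOn h2))
  refine h3.congr fun z hz => ?_
  ext u w <;> simp [formInChart_bcwp_apply gB gF ψ μ x hz, P, Q]
/-- The `(ψ, μ)`-base conformal warped product `B × F`, with the metric
`ψ^{2μ} g_B + ψ^2 g_F`. -/
def bcwp (gB : PseudoRiemannianMetric IB B) (gF : PseudoRiemannianMetric IF F)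
    (ψ : B → ℝ) (hψ : ContMDiff IB 𝓘(ℝ, ℝ) ∞ ψ) (hpos : ∀ b, 0 < ψ b) (μ : ℝ) :
    PseudoRiemannianMetric (IB.prod IF) (B × F) where
  form := bcwpForm gB gF ψ μ
  symm p u w := by
    refine (bcwpForm_apply gB gF ψ μ p u w).trans
      (Eq.trans ?_ (bcwpForm_apply gB gF ψ μ p w u).symm)
    exact congrArg₂ (fun a b => ψ p.1 ^ (2 * μ) * a + ψ p.1 ^ 2 * b)
      (gB.symm p.1 u.1 w.1) (gF.symm p.2 u.2 w.2)
  nondegenerate p u hu := by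
    have h1 : (u : EB × EF).1 = 0 := by
      refine gB.nondegenerate p.1 _ fun w => ?_
      have h := (bcwpForm_apply gB gF ψ μ p u ((w, 0) : EB × EF)).symm.trans (hu _)
      simp only [map_zero, mul_zero, add_zero] at h
      exact (mul_eq_zero.mp h).resolve_left (Real.rpow_pos_of_pos (hpos _) _).ne'
    have h2 : (u : EB × EF).2 = 0 := by
      refine gF.nondegenerate p.2 _ fun w => ?_
      have h := (bcwpForm_apply gB gF ψ μ p u ((0, w) : EB × EF)).symm.trans (hu _)
      simp only [map_zero, mul_zero, zero_add] at h
      exact (mul_eq_zero.mp h).resolve_left (pow_pos (hpos _) 2).ne'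
    exact Prod.ext h1 h2
  smooth := contDiffOn_formInChart_bcwp gB gF ψ hψ hpos μ

end Product

end

/-! In an arclength parameter `dt = ψ ^ μ dr` the metric is the ordinary warped product `ε dt² + ψ²
g_F`, and `W = ψ ^ (-μ) ψ'` (`warpingSpeed`) is the derivative of `ψ` in `t`. The proof keeps the
coordinate `r` but writes everything through `W`. The chart computation `IsWarped.ricci_eq`,
specialised in `ricci_bcwp`, turns the Einstein condition into two equations on the base
(`ricci_bcwp_eq_smul_iff`): `ε W' = -(λ/k) ψ ψ^μ` and `(k-1) (ε W² + (λ/k) ψ²) = ν`. Since `v' =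
(1-μ) W`, the second one is `(*)`.

If `g` is Einstein, the first equation determines `λ` from `r` alone. Differentiating the second and
using the first leaves `λ' ψ² = 0`, so `λ` is constant. Conversely, differentiating `(*)` gives `W Q
= 0` with `Q = ε W' + (λ/k) ψ ψ^μ`. Cancelling `W` needs an argument, because `W` may have zeros: a
connectedness argument (`secondOrder_of_firstOrder`) shows that `Q ≠ 0` at one point would force `ψ`
to be constant. For constant `ψ` both `W` and `W'` vanish, and the two equations reduce to `λ = 0`
and `ν = 0`. -/

namespace CoordGeom

/-! ### Christoffel symbols of a field of nondegenerate forms. -/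

variable {E : Type*} [NormedAddCommGroup E] [NormedSpace ℝ E]

/-- `ContinuousLinearMap.inverse` is zero off the invertible maps, so this is what gives
`christoffel` its intended meaning. -/
theorem isInvertible_of_nondegenerate [FiniteDimensional ℝ E]
    {L : E →L[ℝ] E →L[ℝ] ℝ}
    (hL : ∀ u, (∀ w, L u w = 0) → u = 0) : L.IsInvertible := by
  have hinj : Function.Injective (L : E →ₗ[ℝ] E →L[ℝ] ℝ) := by
    refine (injective_iff_map_eq_zero _).mpr fun u hu => hL u fun w => ?_
    exact congrArg (fun f : E →L[ℝ] ℝ => f w) hu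
  have hdim : Module.finrank ℝ E = Module.finrank ℝ (E →L[ℝ] ℝ) := by
    rw [← (LinearMap.toContinuousLinearMap (𝕜 := ℝ) (E := E) (F' := ℝ)).finrank_eq]
    exact Subspace.dual_finrank_eq.symm
  refine ⟨(LinearEquiv.ofInjectiveOfFinrankEq _ hinj hdim).toContinuousLinearEquiv, ?_⟩
  ext u w
  rfl

theorem christoffel_eq_of_apply_eq {G : E → E →L[ℝ] E →L[ℝ] ℝ} {z u w x : E}
    (hG : (G z).IsInvertible) (h : G z x = koszul G z u w) : christoffel G z u w = x := by
  rw [christoffel_apply, ← h, hG.inverse_apply_self]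

theorem differentiableAt_christoffel [FiniteDimensional ℝ E]
    {G : E → E →L[ℝ] E →L[ℝ] ℝ} {z : E}
    (hG : ContDiffAt ℝ ∞ G z) (hi : (G z).IsInvertible) :
    DifferentiableAt ℝ (christoffel G) z := by
  have hd : DifferentiableAt ℝ (fderiv ℝ G) z :=
    (hG.fderiv_right (m := 1) (by norm_cast)).differentiableAt one_ne_zero
  have hinv : DifferentiableAt ℝ (fun y => (G y).inverse) z :=
    ((hi.contDiffAt_map_inverse (n := 1)).comp z (hG.of_le (by norm_cast))).differentiableAt
      one_ne_zero
  have hk : DifferentiableAt ℝ (koszul G) z := by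
    have hf : DifferentiableAt ℝ (fun y => (fderiv ℝ G y).flip) z :=
      (ContinuousLinearMap.flipₗᵢ ℝ E E (E →L[ℝ] ℝ)).toContinuousLinearEquiv.differentiableAt.comp
        z hd
    have h := ((hd.add hf).sub ((differentiableAt_const
      (ContinuousLinearMap.flipₗᵢ ℝ E E ℝ).toContinuousLinearEquiv.toContinuousLinearMap).clm_comp
        hf)).const_smul (1 / 2 : ℝ)
    exact h
  unfold christoffel
  exact ((ContinuousLinearMap.compL ℝ E (E →L[ℝ] ℝ) E).differentiableAt.comp z hinv).clm_comp hk

theorem koszul_symm {G : E → E →L[ℝ] E →L[ℝ] ℝ} {z : E}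
    (hG : DifferentiableAt ℝ G z) (hs : ∀ᶠ y in nhds z, ∀ u w, G y u w = G y w u) (u w : E) :
    koszul G z u w = koszul G z w u := by
  have key : ∀ t, fderiv ℝ G z t u w = fderiv ℝ G z t w u := fun t => by
    have h1 : ∀ a b : E, HasFDerivAt (fun y => G y a b)
        (((ContinuousLinearMap.apply ℝ ℝ b).comp
          (ContinuousLinearMap.apply ℝ (E →L[ℝ] ℝ) a)).comp (fderiv ℝ G z)) z := fun a b =>
      ((ContinuousLinearMap.apply ℝ ℝ b).comp
          (ContinuousLinearMap.apply ℝ (E →L[ℝ] ℝ) a)).hasFDerivAt.comp z hG.hasFDerivAt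
    have h2 := ((h1 u w).congr_of_eventuallyEq
      (hs.mono fun y hy => hy w u)).unique (h1 w u)
    exact congrArg (fun f : E →L[ℝ] ℝ => f t) h2
  ext t
  rw [koszul_apply, koszul_apply, key t]
  ring

/-- Torsion-freeness. In `IsWarped.ricci_eq` it cancels the mixed terms that contain the Christoffel
symbols of the fibre. -/
theorem christoffel_symm {G : E → E →L[ℝ] E →L[ℝ] ℝ} {z : E}
    (hG : DifferentiableAt ℝ G z) (hs : ∀ᶠ y in nhds z, ∀ u w, G y u w = G y w u) (u w : E) :
    christoffel G z u w = christoffel G z w u := by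
  rw [christoffel_apply, christoffel_apply, koszul_symm hG hs]

theorem hasFDerivAt_apply_apply {E₂ F G : Type*} [NormedAddCommGroup E₂] [NormedSpace ℝ E₂]
    [NormedAddCommGroup F] [NormedSpace ℝ F]
    [NormedAddCommGroup G] [NormedSpace ℝ G] {T : E → E₂ →L[ℝ] F →L[ℝ] G} {z : E}
    (hT : DifferentiableAt ℝ T z) (v : E₂) (w : F) :
    HasFDerivAt (fun y => T y v w)
      (((ContinuousLinearMap.apply ℝ G w).comp
        (ContinuousLinearMap.apply ℝ (F →L[ℝ] G) v)).comp (fderiv ℝ T z)) z :=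
  ((ContinuousLinearMap.apply ℝ G w).comp
        (ContinuousLinearMap.apply ℝ (F →L[ℝ] G) v)).hasFDerivAt.comp z hT.hasFDerivAt

/-! ### Connection and Ricci tensor of a warped product in coordinates. -/

/-- The trace of an endomorphism of `ℝ × E` is the sum of the traces of its diagonal blocks. -/
theorem trace_real_prod [FiniteDimensional ℝ E]
    (L : ℝ × E →ₗ[ℝ] ℝ × E) :
    LinearMap.trace ℝ (ℝ × E) L = (L (1, 0)).1 +
      LinearMap.trace ℝ E (LinearMap.snd ℝ ℝ E ∘ₗ L ∘ₗ LinearMap.inr ℝ ℝ E) := by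
  have h : L = (L ∘ₗ LinearMap.inl ℝ ℝ E) ∘ₗ LinearMap.fst ℝ ℝ E +
      (L ∘ₗ LinearMap.inr ℝ ℝ E) ∘ₗ LinearMap.snd ℝ ℝ E := by
    refine LinearMap.ext fun x => ?_
    simp [← map_add]
  have h1 : LinearMap.fst ℝ ℝ E ∘ₗ (L ∘ₗ LinearMap.inl ℝ ℝ E) =
      (LinearMap.id).smulRight (L (1, 0)).1 := by
    ext; simp
  conv_lhs => rw [h]
  rw [map_add, LinearMap.trace_comp_comm' (LinearMap.fst ℝ ℝ E),
    LinearMap.trace_comp_comm' (LinearMap.snd ℝ ℝ E), h1, LinearMap.trace_smulRight]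
  rfl

/-- On `U × V`, the field of forms `G` is the warped product `A ds² + b H`, where `α`, `β`, `γ`
are the functions of `s` that appear in its Christoffel symbols. -/
structure IsWarped (U : Set ℝ) (V : Set E) (A b α β γ : ℝ → ℝ) (H : E → E →L[ℝ] E →L[ℝ] ℝ)
    (G : ℝ × E → ℝ × E →L[ℝ] ℝ × E →L[ℝ] ℝ) : Prop where
  isOpen_base : IsOpen U
  isOpen_fiber : IsOpen V
  smooth_fiber : ContDiffOn ℝ ∞ H V
  smooth : ContDiffOn ℝ ∞ G (U ×ˢ V)
  symm_fiber : ∀ y ∈ V, ∀ u w, H y u w = H y w u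
  nondegenerate_fiber : ∀ y ∈ V, ∀ u, (∀ w, H y u w = 0) → u = 0
  nondegenerate : ∀ z ∈ U ×ˢ V, ∀ u, (∀ w, G z u w = 0) → u = 0
  apply : ∀ z ∈ U ×ˢ V, ∀ u w, G z u w = A z.1 * (u.1 * w.1) + b z.1 * H z.2 u.2 w.2
  hasDerivAt_base : ∀ s ∈ U, HasDerivAt A (2 * (A s * α s)) s
  hasDerivAt_warping : ∀ s ∈ U, HasDerivAt b (2 * (b s * β s)) s
  base_mul : ∀ s ∈ U, A s * γ s = -(b s * β s)

namespace IsWarped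

variable {U : Set ℝ} {V : Set E} {A b α β γ : ℝ → ℝ} {H : E → E →L[ℝ] E →L[ℝ] ℝ}
  {G : ℝ × E → ℝ × E →L[ℝ] ℝ × E →L[ℝ] ℝ}

theorem mem_nhds (h : IsWarped U V A b α β γ H G) {z : ℝ × E} (hz : z ∈ U ×ˢ V) :
    U ×ˢ V ∈ nhds z := (h.isOpen_base.prod h.isOpen_fiber).mem_nhds hz

theorem fderiv_apply (h : IsWarped U V A b α β γ H G) {z : ℝ × E} (hz : z ∈ U ×ˢ V)
    (t u w : ℝ × E) :
    fderiv ℝ G z t u w = 2 * (A z.1 * α z.1) * t.1 * (u.1 * w.1) +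
      (2 * (b z.1 * β z.1) * t.1 * H z.2 u.2 w.2 + b z.1 * fderiv ℝ H z.2 t.2 u.2 w.2) := by
  have hG := (h.smooth.contDiffAt (h.mem_nhds hz)).differentiableAt (by simp)
  have hH := (h.smooth_fiber.contDiffAt (h.isOpen_fiber.mem_nhds hz.2)).differentiableAt (by simp)
  have e : (fun y => G y u w) =ᶠ[nhds z]
      fun y => A y.1 * (u.1 * w.1) + b y.1 * H y.2 u.2 w.2 :=
    Filter.eventually_of_mem (h.mem_nhds hz) fun y hy => h.apply y hy u w
  have hA := (h.hasDerivAt_base _ hz.1).hasFDerivAt.comp z hasFDerivAt_fst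
  have hb := (h.hasDerivAt_warping _ hz.1).hasFDerivAt.comp z hasFDerivAt_fst
  have hH' := (hasFDerivAt_apply_apply hH u.2 w.2).comp z hasFDerivAt_snd
  have h1 := ((hA.mul_const (u.1 * w.1)).add (hb.mul hH')).congr_of_eventuallyEq e
  have h2 := congrArg (fun f : ℝ × E →L[ℝ] ℝ => f t)
    ((hasFDerivAt_apply_apply hG u w).unique h1)
  simp at h2
  rw [h2]
  ring

/-- By nondegeneracy it suffices to pair the claimed vector with every `t` and compare with
`koszul`. The only discrepancy is in the term `t.1 * H`, and `base_mul` removes it. -/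
theorem christoffel_eq [FiniteDimensional ℝ E] (h : IsWarped U V A b α β γ H G) {z : ℝ × E}
    (hz : z ∈ U ×ˢ V) (u w : ℝ × E) :
    christoffel G z u w = (α z.1 * (u.1 * w.1) + γ z.1 * H z.2 u.2 w.2,
      β z.1 • (u.1 • w.2 + w.1 • u.2) + christoffel H z.2 u.2 w.2) := by
  refine christoffel_eq_of_apply_eq (isInvertible_of_nondegenerate (h.nondegenerate z hz)) ?_
  refine ContinuousLinearMap.ext fun t => ?_
  rw [h.apply z hz, koszul_apply, h.fderiv_apply hz, h.fderiv_apply hz, h.fderiv_apply hz,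
    christoffel_apply]
  simp only [map_add, map_smul, add_apply, smul_apply,
    smul_eq_mul]
  rw [(isInvertible_of_nondegenerate (h.nondegenerate_fiber z.2 hz.2)).self_apply_inverse,
    koszul_apply]
  linear_combination (t.1 * H z.2 u.2 w.2) * h.base_mul z.1 hz.1

theorem fderiv_christoffel [FiniteDimensional ℝ E] (h : IsWarped U V A b α β γ H G) {z : ℝ × E}
    (hz : z ∈ U ×ˢ V) {α' β' γ' : ℝ} (hα : HasDerivAt α α' z.1) (hβ : HasDerivAt β β' z.1)
    (hγ : HasDerivAt γ γ' z.1) (t u w : ℝ × E) :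
    fderiv ℝ (christoffel G) z t u w =
      (α' * t.1 * (u.1 * w.1) + (γ' * t.1 * H z.2 u.2 w.2 + γ z.1 * fderiv ℝ H z.2 t.2 u.2 w.2),
        (β' * t.1) • (u.1 • w.2 + w.1 • u.2) + fderiv ℝ (christoffel H) z.2 t.2 u.2 w.2) := by
  have cG := h.smooth.contDiffAt (h.mem_nhds hz)
  have cH := h.smooth_fiber.contDiffAt (h.isOpen_fiber.mem_nhds hz.2)
  have hG := differentiableAt_christoffel cG (isInvertible_of_nondegenerate (h.nondegenerate z hz))
  have hH := differentiableAt_christoffel cH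
    (isInvertible_of_nondegenerate (h.nondegenerate_fiber z.2 hz.2))
  have e : (fun y => christoffel G y u w) =ᶠ[nhds z]
      fun y => (α y.1 * (u.1 * w.1) + γ y.1 * H y.2 u.2 w.2,
        β y.1 • (u.1 • w.2 + w.1 • u.2) + christoffel H y.2 u.2 w.2) :=
    Filter.eventually_of_mem (h.mem_nhds hz) fun y hy => h.christoffel_eq hy u w
  have hα' := hα.hasFDerivAt.comp z hasFDerivAt_fst
  have hβ' := hβ.hasFDerivAt.comp z hasFDerivAt_fst
  have hγ' := hγ.hasFDerivAt.comp z hasFDerivAt_fst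
  have hH' := (hasFDerivAt_apply_apply (cH.differentiableAt (by simp)) u.2 w.2).comp z
    hasFDerivAt_snd
  have hc := (hasFDerivAt_apply_apply hH u.2 w.2).comp z hasFDerivAt_snd
  have h1 := (((hα'.mul_const (u.1 * w.1)).add (hγ'.mul hH')).prodMk
    ((hβ'.smul_const (u.1 • w.2 + w.1 • u.2)).add hc)).congr_of_eventuallyEq e
  have h2 := congrArg (fun f : ℝ × E →L[ℝ] ℝ × E => f t)
    ((hasFDerivAt_apply_apply hG u w).unique h1)
  simp at h2
  rw [h2]
  refine Prod.ext ?_ ?_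
  · simp; ring
  · simp [mul_comm]

/-- Only the two diagonal blocks of `u ↦ R(u,v)w` enter the trace. The coefficient `dim E - 2` of `β
γ` collects `-1` from the base block, `dim E` from a multiple of the identity and `-1` from a
rank-one map. -/
theorem ricci_eq [FiniteDimensional ℝ E] (h : IsWarped U V A b α β γ H G) {z : ℝ × E}
    (hz : z ∈ U ×ˢ V) {α' β' γ' : ℝ} (hα : HasDerivAt α α' z.1) (hβ : HasDerivAt β β' z.1)
    (hγ : HasDerivAt γ γ' z.1) (v w : ℝ × E) :
    ricci G z v w = ricci H z.2 v.2 w.2 +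
      Module.finrank ℝ E * (-β' + α z.1 * β z.1 - β z.1 ^ 2) * (v.1 * w.1) +
      (γ' + α z.1 * γ z.1 + (Module.finrank ℝ E - 2) * β z.1 * γ z.1) * H z.2 v.2 w.2 := by
  have cH := h.smooth_fiber.contDiffAt (h.isOpen_fiber.mem_nhds hz.2)
  have sH := christoffel_symm (cH.differentiableAt (by simp))
    (Filter.eventually_of_mem (h.isOpen_fiber.mem_nhds hz.2) h.symm_fiber)
  have h1 : (curvature G z v w (1, 0)).1 = (γ' + α z.1 * γ z.1 - β z.1 * γ z.1) *
      H z.2 v.2 w.2 := by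
    simp only [curvature, LinearMap.coe_mk, AddHom.coe_mk, h.fderiv_christoffel hz hα hβ hγ,
      h.christoffel_eq hz]
    simp
    ring
  have h2 : LinearMap.snd ℝ ℝ E ∘ₗ curvature G z v w ∘ₗ LinearMap.inr ℝ ℝ E =
      curvature H z.2 v.2 w.2 + ((-β' + α z.1 * β z.1 - β z.1 ^ 2) * (v.1 * w.1) +
        β z.1 * γ z.1 * H z.2 v.2 w.2) • LinearMap.id -
        (β z.1 * γ z.1) • ((H z.2).flip w.2 : E →ₗ[ℝ] ℝ).smulRight v.2 := by
    ext1 u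
    simp only [curvature, LinearMap.coe_mk, AddHom.coe_mk, h.fderiv_christoffel hz hα hβ hγ,
      h.christoffel_eq hz, LinearMap.comp_apply, LinearMap.inr_apply, LinearMap.snd_apply,
      LinearMap.add_apply, LinearMap.sub_apply, LinearMap.smul_apply, LinearMap.smulRight_apply,
      LinearMap.id_apply, Prod.snd_add, Prod.snd_sub, map_add, map_smul,
      zero_smul, mul_zero, zero_mul, sH v.2 u, ContinuousLinearMap.coe_coe,
      ContinuousLinearMap.flip_apply]
    module
  unfold ricci
  rw [trace_real_prod, h1, h2, map_sub, map_add, map_smul, map_smul, LinearMap.trace_id,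
    LinearMap.trace_smulRight]
  simp
  ring

end IsWarped

end CoordGeom

/-! ### Forms in charts and on tangent spaces. -/

section FormInChart

variable {E : Type*} [NormedAddCommGroup E] [NormedSpace ℝ E]
  {H : Type*} [TopologicalSpace H] {I : ModelWithCorners ℝ E H}
  {M : Type*} [TopologicalSpace M] [ChartedSpace H M]

theorem PseudoRiemannianMetric.formInChart_symm (g : PseudoRiemannianMetric I M) (x : M)
    (z u w : E) : formInChart I g.form x z u w = formInChart I g.form x z w u :=
  g.symm ((extChartAt I x).symm z)
    ((show E →L[ℝ] E from mfderiv 𝓘(ℝ, E) I (extChartAt I x).symm z) u)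
    ((show E →L[ℝ] E from mfderiv 𝓘(ℝ, E) I (extChartAt I x).symm z) w)

variable [I.Boundaryless] [IsManifold I ∞ M]

theorem formInChart_self (g : ∀ x : M, TangentSpace I x →L[ℝ] TangentSpace I x →L[ℝ] ℝ)
    (x : M) (u w : E) :
    formInChart I g x (extChartAt I x x) u w =
      (show E →L[ℝ] E →L[ℝ] ℝ from g x) u w := by
  have : IsManifold I 1 M := IsManifold.of_le (n := ∞) (by norm_cast)
  have hD := mfderivWithin_range_extChartAt_symm (I := I) (x := x)
  rw [I.range_eq_univ, mfderivWithin_univ] at hD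
  have hD' : ∀ a : E, (show E →L[ℝ] E from
      mfderiv 𝓘(ℝ, E) I (extChartAt I x).symm (extChartAt I x x)) a = a := fun a =>
    congrArg (fun L : E →L[ℝ] E => L a) hD
  -- The type of `g y` depends on `y`, so the base point is generalised before it is identified with
  -- `x`.
  have hg : ∀ y, y = x → (show E →L[ℝ] E →L[ℝ] ℝ from g y) =
      (show E →L[ℝ] E →L[ℝ] ℝ from g x) := by
    rintro y rfl; rfl
  have h := hg _ (extChartAt_to_inv (I := I) x)
  exact (congrArg₂ (fun a b => (show E →L[ℝ] E →L[ℝ] ℝ from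
    g ((extChartAt I x).symm (extChartAt I x x))) a b) (hD' u) (hD' w)).trans
    (congrArg (fun L : E →L[ℝ] E →L[ℝ] ℝ => L u w) h)

theorem PseudoRiemannianMetric.formInChart_nondegenerate (g : PseudoRiemannianMetric I M) (x : M)
    {z : E} (hz : z ∈ (extChartAt I x).target) (u : E)
    (hu : ∀ w, formInChart I g.form x z u w = 0) : u = 0 := by
  have : IsManifold I 1 M := IsManifold.of_le (n := ∞) (by norm_cast)
  have hD := isInvertible_mfderivWithin_extChartAt_symm (I := I) hz
  rw [I.range_eq_univ, mfderivWithin_univ] at hD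
  obtain ⟨e, he⟩ : ∃ e : E ≃L[ℝ] E, (e : E →L[ℝ] E) =
    (show E →L[ℝ] E from mfderiv 𝓘(ℝ, E) I (extChartAt I x).symm z) := hD
  have hu' : ∀ w : E, (show E →L[ℝ] E →L[ℝ] ℝ from g.form ((extChartAt I x).symm z))
      ((e : E →L[ℝ] E) u) ((e : E →L[ℝ] E) w) = 0 := by
    rw [he]
    exact hu
  have h0 : e u = 0 := by
    refine g.nondegenerate ((extChartAt I x).symm z) (e u) fun w => ?_
    have h := hu' (e.symm w)
    rwa [show (e : E →L[ℝ] E) (e.symm w) = w from e.apply_symm_apply w] at h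
  exact (map_eq_zero_iff e e.injective).mp h0

end FormInChart

/-! ### Calculus on the base, transported to the real line. -/

section Interval

variable {B : TopologicalSpace.Opens ℝ}

/-- Extension by zero of a function on an open subset of the line. -/
noncomputable def extendToReal (f : B → ℝ) : ℝ → ℝ := Function.extend Subtype.val f 0

theorem extendToReal_coe (f : B → ℝ) (r : B) : extendToReal f r = f r :=
  Subtype.val_injective.extend_apply _ _ _

theorem extChartAt_opens_self (r : B) : extChartAt 𝓘(ℝ, ℝ) r r = (r : ℝ) := by
  rw [← coe_comp_chart_symm B r (mem_extChartAt_target r), extChartAt_to_inv]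

theorem extendToReal_chart (f : B → ℝ) (r : B) {z : ℝ} (hz : z ∈ (extChartAt 𝓘(ℝ, ℝ) r).target) :
    extendToReal f z = f ((extChartAt 𝓘(ℝ, ℝ) r).symm z) := by
  rw [← extendToReal_coe f, coe_comp_chart_symm B r hz]

theorem chart_target_subset (r : B) {z : ℝ} (hz : z ∈ (extChartAt 𝓘(ℝ, ℝ) r).target) : z ∈ B := by
  rw [← coe_comp_chart_symm B r hz]
  exact Subtype.coe_prop _

theorem contDiffAt_extendToReal {f : B → ℝ} (hf : ContMDiff 𝓘(ℝ, ℝ) 𝓘(ℝ, ℝ) ∞ f) {s : ℝ}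
    (hs : s ∈ B) : ContDiffAt ℝ ∞ (extendToReal f) s := by
  let r : B := ⟨s, hs⟩
  have hr : s ∈ (extChartAt 𝓘(ℝ, ℝ) r).target := by
    simpa only [extChartAt_opens_self] using mem_extChartAt_target (I := 𝓘(ℝ, ℝ)) r
  have h := contMDiffOn_iff_contDiffOn.mp
    (hf.comp_contMDiffOn (contMDiffOn_extChartAt_symm (I := 𝓘(ℝ, ℝ)) (n := ∞) r))
  exact (h.congr fun z hz => extendToReal_chart f r hz).contDiffAt
    ((isOpen_extChartAt_target r).mem_nhds hr)

/-- The chart of `B` is the inclusion, so near `r` the chart expression of `f` agrees with its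
extension by zero. -/
theorem derivR_eq_deriv {f : B → ℝ} (hf : ContMDiff 𝓘(ℝ, ℝ) 𝓘(ℝ, ℝ) ∞ f) (r : B) :
    derivR f r = deriv (extendToReal f) r := by
  have hd : MDifferentiableAt 𝓘(ℝ, ℝ) 𝓘(ℝ, ℝ) f r := hf.mdifferentiable (by simp) r
  have he : writtenInExtChartAt 𝓘(ℝ, ℝ) 𝓘(ℝ, ℝ) r f =ᶠ[nhds (extChartAt 𝓘(ℝ, ℝ) r r)]
      extendToReal f := by
    filter_upwards [eventually_mem_chart_target B r (mem_extChartAt_target r)] with y hy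
    exact (extendToReal_chart f r hy).symm
  have h : (show ℝ →L[ℝ] ℝ from mfderiv 𝓘(ℝ, ℝ) 𝓘(ℝ, ℝ) f r) =
      fderiv ℝ (extendToReal f) r := by
    refine hd.mfderiv.trans ?_
    rw [ModelWithCorners.range_eq_univ, fderivWithin_univ, he.fderiv_eq, extChartAt_opens_self]
  exact congrArg (fun L : ℝ →L[ℝ] ℝ => L 1) h

/-- The derivative of `ψ` divided by `ψ ^ μ`. -/
noncomputable def warpingSpeed (ψ : B → ℝ) (μ : ℝ) (s : ℝ) : ℝ :=
  extendToReal ψ s ^ (-μ) * deriv (extendToReal ψ) s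

section Positive

variable {ψ : B → ℝ}

theorem extendToReal_pos (hpos : ∀ r, 0 < ψ r) {s : ℝ} (hs : s ∈ B) : 0 < extendToReal ψ s := by
  rw [show s = ((⟨s, hs⟩ : B) : ℝ) from rfl, extendToReal_coe]
  exact hpos _

theorem hasDerivAt_extendToReal (hψ : ContMDiff 𝓘(ℝ, ℝ) 𝓘(ℝ, ℝ) ∞ ψ)
    (hpos : ∀ r, 0 < ψ r) (μ : ℝ) {s : ℝ} (hs : s ∈ B) :
    HasDerivAt (extendToReal ψ) (extendToReal ψ s ^ μ * warpingSpeed ψ μ s) s := by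
  have h := ((contDiffAt_extendToReal hψ hs).differentiableAt (by simp)).hasDerivAt
  rwa [warpingSpeed, ← mul_assoc, ← Real.rpow_add (extendToReal_pos hpos hs), add_neg_cancel,
    Real.rpow_zero, one_mul]

theorem contDiffAt_warpingSpeed (hψ : ContMDiff 𝓘(ℝ, ℝ) 𝓘(ℝ, ℝ) ∞ ψ)
    (hpos : ∀ r, 0 < ψ r) (μ : ℝ) {s : ℝ} (hs : s ∈ B) :
    ContDiffAt ℝ ∞ (warpingSpeed ψ μ) s := by
  have h := contDiffAt_extendToReal hψ hs
  exact (h.rpow_const_of_ne (extendToReal_pos hpos hs).ne').mul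
    (h.derivWithin (m := ∞) (by norm_cast))

theorem hasDerivAt_warpingSpeed (hψ : ContMDiff 𝓘(ℝ, ℝ) 𝓘(ℝ, ℝ) ∞ ψ)
    (hpos : ∀ r, 0 < ψ r) (μ : ℝ) {s : ℝ} (hs : s ∈ B) :
    HasDerivAt (warpingSpeed ψ μ) (deriv (warpingSpeed ψ μ) s) s :=
  ((contDiffAt_warpingSpeed hψ hpos μ hs).differentiableAt (by simp)).hasDerivAt

/-- Only `ψ`, `ψ ^ μ` and `W` occur in the derivative, so later identities become rational in these
quantities. -/
theorem hasDerivAt_rpow_extendToReal (hψ : ContMDiff 𝓘(ℝ, ℝ) 𝓘(ℝ, ℝ) ∞ ψ)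
    (hpos : ∀ r, 0 < ψ r) (μ : ℝ) {s : ℝ} (hs : s ∈ B) :
    HasDerivAt (fun t => extendToReal ψ t ^ μ)
      (μ * (extendToReal ψ s ^ μ) ^ 2 * warpingSpeed ψ μ s / extendToReal ψ s) s := by
  have h0 := extendToReal_pos hpos hs
  have h := (hasDerivAt_extendToReal hψ hpos μ hs).rpow_const (p := μ) (Or.inl h0.ne')
  convert! h using 1
  rw [Real.rpow_sub_one h0.ne']
  field_simp

end Positive

end Interval

/-! ### The Ricci tensor of the base conformal warped product. -/

section Warped

variable {k : ℕ} {F : Type*} [TopologicalSpace F] [ChartedSpace (EuclideanSpace ℝ (Fin k)) F]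
  [IsManifold (𝓡 k) ∞ F] (gF : PseudoRiemannianMetric (𝓡 k) F)
  {B : TopologicalSpace.Opens ℝ} (ε : ℤˣ) {ψ : B → ℝ}
  (hψ : ContMDiff 𝓘(ℝ, ℝ) 𝓘(ℝ, ℝ) ∞ ψ) (hpos : ∀ r, 0 < ψ r) (μ : ℝ)

theorem units_cast_mul_self (ε : ℤˣ) : ((ε : ℤ) : ℝ) * ((ε : ℤ) : ℝ) = 1 := by
  rcases Int.units_eq_one_or ε with rfl | rfl <;> simp

/-- With `ψ' = ψ ^ μ W`, the coefficients are `α = A' / (2A) = μ ψ' / ψ`, `β = b' / (2b) = ψ' / ψ`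
and `γ = -b β / A`, where `1 / ε = ε`. -/
theorem isWarped_bcwp (p : B × F) :
    CoordGeom.IsWarped (extChartAt 𝓘(ℝ, ℝ) p.1).target (extChartAt (𝓡 k) p.2).target
      (fun s => ((ε : ℤ) : ℝ) * (extendToReal ψ s ^ μ) ^ 2)
      (fun s => extendToReal ψ s ^ 2)
      (fun s => μ * (extendToReal ψ s ^ μ * warpingSpeed ψ μ s / extendToReal ψ s))
      (fun s => extendToReal ψ s ^ μ * warpingSpeed ψ μ s / extendToReal ψ s)
      (fun s => -((ε : ℤ) : ℝ) * (extendToReal ψ s * warpingSpeed ψ μ s / extendToReal ψ s ^ μ))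
      (formInChart (𝓡 k) gF.form p.2)
      (formInChart (𝓘(ℝ, ℝ).prod (𝓡 k)) (bcwp (intervalMetric B ε) gF ψ hψ hpos μ).form p) := by
  have ht : (extChartAt (𝓘(ℝ, ℝ).prod (𝓡 k)) p).target =
      (extChartAt 𝓘(ℝ, ℝ) p.1).target ×ˢ (extChartAt (𝓡 k) p.2).target := by
    rw [extChartAt_prod]; rfl
  have hP : ∀ s ∈ (extChartAt 𝓘(ℝ, ℝ) p.1).target, 0 < extendToReal ψ s := fun s hs =>
    extendToReal_pos hpos (chart_target_subset _ hs)
  refine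
    { isOpen_base := isOpen_extChartAt_target _
      isOpen_fiber := isOpen_extChartAt_target _
      smooth_fiber := gF.smooth _
      smooth := ht ▸ (bcwp (intervalMetric B ε) gF ψ hψ hpos μ).smooth p
      symm_fiber := fun y _ u w => gF.formInChart_symm _ _ _ _
      nondegenerate_fiber := fun y hy => gF.formInChart_nondegenerate _ hy
      nondegenerate := fun z hz =>
        (bcwp (intervalMetric B ε) gF ψ hψ hpos μ).formInChart_nondegenerate _ (ht ▸ hz)
      apply := fun z hz u w => ?_
      hasDerivAt_base := fun s hs => ?_
      hasDerivAt_warping := fun s hs => ?_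
      base_mul := fun s hs => ?_ }
  · refine (formInChart_bcwp_apply (intervalMetric B ε) gF ψ μ p (ht ▸ hz) u w).trans ?_
    rw [extendToReal_chart ψ p.1 hz.1, mul_comm 2 μ, Real.rpow_mul (hpos _).le, Real.rpow_two]
    have h := formInChart_intervalForm_apply B ε p.1 hz.1 u.1 w.1
    rw [show (intervalMetric B ε).form = intervalForm B ε from rfl, h]
    ring
  · have h := ((hasDerivAt_rpow_extendToReal hψ hpos μ (chart_target_subset _ hs)).pow 2).const_mul
      ((ε : ℤ) : ℝ)
    convert! h using 1
    push_cast
    ring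
  · have h := (hasDerivAt_extendToReal hψ hpos μ (chart_target_subset _ hs)).pow 2
    convert! h using 1
    have := (hP s hs).ne'
    field_simp
    push_cast
    ring
  · have := (hP s hs).ne'
    have := (Real.rpow_pos_of_pos (hP s hs) μ).ne'
    field_simp
    linear_combination (-warpingSpeed ψ μ s) * units_cast_mul_self ε

/-- In the base direction the terms in `W²` of `-β' + α β - β²` cancel, leaving `-ψ ^ μ W' / ψ`.
This is the gain from using `W` instead of `ψ'`. -/
theorem ricci_bcwp (p : B × F) (u w : ℝ × EuclideanSpace ℝ (Fin k)) :
    (bcwp (intervalMetric B ε) gF ψ hψ hpos μ).ricci p u w =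
      gF.ricci p.2 u.2 w.2 -
        k * (ψ p.1 ^ μ * deriv (warpingSpeed ψ μ) p.1 / ψ p.1) * (u.1 * w.1) -
        ((ε : ℤ) : ℝ) * ((k - 1) * warpingSpeed ψ μ p.1 ^ 2 +
          ψ p.1 * deriv (warpingSpeed ψ μ) p.1 / ψ p.1 ^ μ) *
          (show EuclideanSpace ℝ (Fin k) →L[ℝ] EuclideanSpace ℝ (Fin k) →L[ℝ] ℝ from
            gF.form p.2) u.2 w.2 := by
  have hb : (p.1 : ℝ) ∈ B := p.1.2
  have hP := hpos p.1
  have hPμ := Real.rpow_pos_of_pos hP μ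
  have e : extChartAt (𝓘(ℝ, ℝ).prod (𝓡 k)) p p =
      ((p.1 : ℝ), extChartAt (𝓡 k) p.2 p.2) := by
    rw [extChartAt_prod]
    exact Prod.ext (extChartAt_opens_self p.1) rfl
  have hz : ((p.1 : ℝ), extChartAt (𝓡 k) p.2 p.2) ∈
      (extChartAt 𝓘(ℝ, ℝ) p.1).target ×ˢ (extChartAt (𝓡 k) p.2).target := by
    refine ⟨?_, mem_extChartAt_target p.2⟩
    simpa only [extChartAt_opens_self] using mem_extChartAt_target (I := 𝓘(ℝ, ℝ)) p.1
  have dψ := hasDerivAt_extendToReal hψ hpos μ hb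
  have dP := hasDerivAt_rpow_extendToReal hψ hpos μ hb
  have dW := hasDerivAt_warpingSpeed hψ hpos μ hb
  rw [extendToReal_coe] at dψ dP
  have hne : extendToReal ψ (p.1 : ℝ) ≠ 0 := by rw [extendToReal_coe]; exact hP.ne'
  have hne' : extendToReal ψ (p.1 : ℝ) ^ μ ≠ 0 := by rw [extendToReal_coe]; exact hPμ.ne'
  have dβ := (dP.mul dW).div dψ hne
  have dα := dβ.const_mul μ
  have dγ := ((dψ.mul dW).div dP hne').const_mul (-((ε : ℤ) : ℝ))
  have h := (isWarped_bcwp gF ε hψ hpos μ p).ricci_eq hz dα dβ dγ u w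
  rw [← e] at h
  refine h.trans ?_
  have hform := formInChart_self gF.form p.2 u.2 w.2
  have hric : CoordGeom.ricci (formInChart (𝓡 k) gF.form p.2) (extChartAt (𝓡 k) p.2 p.2) u.2 w.2 =
    gF.ricci p.2 u.2 w.2 := rfl
  simp only [e, hform, hric, Pi.mul_apply, extendToReal_coe, finrank_euclideanSpace_fin]
  generalize (show ℝ from gF.ricci p.2 u.2 w.2) = R
  generalize (show EuclideanSpace ℝ (Fin k) →L[ℝ] EuclideanSpace ℝ (Fin k) →L[ℝ] ℝ from
            gF.form p.2) u.2 w.2 = Q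
  generalize ψ p.1 ^ μ = P at *
  generalize deriv (warpingSpeed ψ μ) p.1 = W'
  generalize warpingSpeed ψ μ p.1 = W
  field_simp
  ring

theorem bcwp_form (p : B × F) (u w : ℝ × EuclideanSpace ℝ (Fin k)) :
    (bcwp (intervalMetric B ε) gF ψ hψ hpos μ).form p u w =
      ((ε : ℤ) : ℝ) * (ψ p.1 ^ μ) ^ 2 * (u.1 * w.1) + ψ p.1 ^ 2 *
          (show EuclideanSpace ℝ (Fin k) →L[ℝ] EuclideanSpace ℝ (Fin k) →L[ℝ] ℝ from
            gF.form p.2) u.2 w.2 := by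
  refine (bcwpForm_apply (intervalMetric B ε) gF ψ μ p u w).trans ?_
  have h := intervalForm_apply B ε p.1 u.1 w.1
  rw [mul_comm 2 μ, Real.rpow_mul (hpos _).le, Real.rpow_two]
  refine congrArg₂ (· + ·) ((congrArg (_ * ·) h).trans ?_) rfl
  ring

end Warped

/-! ### The Einstein condition as a system on the base. -/

section Einstein

variable {k : ℕ} {F : Type*} [TopologicalSpace F] [ChartedSpace (EuclideanSpace ℝ (Fin k)) F]
  [IsManifold (𝓡 k) ∞ F] {gF : PseudoRiemannianMetric (𝓡 k) F}
  {B : TopologicalSpace.Opens ℝ} {ε : ℤˣ} {ψ : B → ℝ}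
  {hψ : ContMDiff 𝓘(ℝ, ℝ) 𝓘(ℝ, ℝ) ∞ ψ} {hpos : ∀ r, 0 < ψ r} {μ : ℝ}

/-- The Einstein condition at a point of the warped product, as two equations in the base. -/
theorem ricci_bcwp_eq_smul_iff (hk : 0 < k) {ν : ℝ} (hF : gF.IsEinstein (fun _ => ν))
    (p : B × F) (l : ℝ) :
    (∀ u w : TangentSpace (𝓘(ℝ, ℝ).prod (𝓡 k)) p,
      (bcwp (intervalMetric B ε) gF ψ hψ hpos μ).ricci p u w =
        l * (bcwp (intervalMetric B ε) gF ψ hψ hpos μ).form p u w) ↔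
    ((ε : ℤ) : ℝ) * deriv (warpingSpeed ψ μ) p.1 = -(l / k * ψ p.1 * ψ p.1 ^ μ) ∧
      ((k : ℝ) - 1) * (((ε : ℤ) : ℝ) * warpingSpeed ψ μ p.1 ^ 2 + l / k * ψ p.1 ^ 2) = ν := by
  have hP := hpos p.1
  have hPμ := Real.rpow_pos_of_pos hP μ
  have hε := units_cast_mul_self ε
  have hk' : (k : ℝ) ≠ 0 := by positivity
  have hric := fun u w => ricci_bcwp gF ε hψ hpos μ p u w
  have hform := fun u w => bcwp_form gF ε hψ hpos μ p u w
  have hF' : ∀ a c : EuclideanSpace ℝ (Fin k), gF.ricci p.2 a c = ν *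
    (show EuclideanSpace ℝ (Fin k) →L[ℝ] EuclideanSpace ℝ (Fin k) →L[ℝ] ℝ from
      gF.form p.2) a c := hF.2 p.2
  constructor
  · intro h
    have h' : ∀ u w : ℝ × EuclideanSpace ℝ (Fin k), _ := fun u w =>
      (hric u w).symm.trans ((h u w).trans (congrArg (l * ·) (hform u w)))
    simp only [hF'] at h'
    -- Two tests suffice: the base direction, and a pair of fibre vectors on which `gF` does not
    -- vanish.
    have h1 := h' (1, 0) (1, 0)
    obtain ⟨a, ha⟩ : ∃ a : EuclideanSpace ℝ (Fin k), a ≠ 0 := by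
      have : Nonempty (Fin k) := ⟨⟨0, hk⟩⟩
      exact exists_ne 0
    obtain ⟨c, hc⟩ : ∃ c : EuclideanSpace ℝ (Fin k),
        (show EuclideanSpace ℝ (Fin k) →L[ℝ] EuclideanSpace ℝ (Fin k) →L[ℝ] ℝ from
          gF.form p.2) a c ≠ 0 := by
      by_contra! hcon
      exact ha (gF.nondegenerate p.2 a hcon)
    have h2 := h' (0, a) (0, c)
    simp only [map_zero, mul_zero, mul_one, add_zero, zero_add, zero_sub, sub_zero] at h1 h2
    have h2' := mul_right_cancel₀ hc ((sub_mul _ _ _).trans (h2.trans (mul_assoc _ _ _).symm))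
    clear h2 h' hric hform hF' h
    generalize ψ p.1 ^ μ = P at *
    generalize deriv (warpingSpeed ψ μ) p.1 = W' at *
    generalize warpingSpeed ψ μ p.1 = W at *
    generalize ψ p.1 = f at *
    have e1 : ((ε : ℤ) : ℝ) * W' = -(l / k * f * P) := by
      field_simp at h1 ⊢
      linear_combination -((ε : ℤ) : ℝ) * h1 - l * P * f * hε
    refine ⟨e1, ?_⟩
    -- Solving for `W'` with `ε² = 1` and substituting makes the fibre equation first order.
    have e2 : W' = -((ε : ℤ) : ℝ) * (l / k * f * P) := by
      linear_combination ((ε : ℤ) : ℝ) * e1 - W' * hε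
    rw [e2] at h2'
    field_simp at h2' ⊢
    linear_combination -h2' + l * f ^ 2 * hε
  · rintro ⟨h1, h2⟩ u w
    refine (hric u w).trans (Eq.trans ?_ (congrArg (l * ·) (hform u w)).symm)
    simp only [hF']
    generalize (show EuclideanSpace ℝ (Fin k) →L[ℝ] EuclideanSpace ℝ (Fin k) →L[ℝ] ℝ from
      gF.form p.2) u.2 w.2 = Q
    clear hric hform hF'
    generalize ψ p.1 ^ μ = P at *
    generalize deriv (warpingSpeed ψ μ) p.1 = W' at *
    generalize warpingSpeed ψ μ p.1 = W at *
    generalize ψ p.1 = f at *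
    have e2 : W' = -((ε : ℤ) : ℝ) * (l / k * f * P) := by
      linear_combination ((ε : ℤ) : ℝ) * h1 - W' * hε
    rw [e2, ← h2]
    field_simp
    linear_combination (l * f ^ 2 * Q) * hε

end Einstein

/-! ### The first integral and its derivative. -/

section ODE

variable {B : TopologicalSpace.Opens ℝ} {ψ : B → ℝ}

theorem contMDiff_rpow_const (hψ : ContMDiff 𝓘(ℝ, ℝ) 𝓘(ℝ, ℝ) ∞ ψ) (hpos : ∀ r, 0 < ψ r)
    (a : ℝ) : ContMDiff 𝓘(ℝ, ℝ) 𝓘(ℝ, ℝ) ∞ (fun r => ψ r ^ a) := fun r =>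
  (Real.contDiffAt_rpow_const_of_ne (hpos r).ne').contMDiffAt.comp r (hψ r)

theorem derivR_rpow_const (hψ : ContMDiff 𝓘(ℝ, ℝ) 𝓘(ℝ, ℝ) ∞ ψ) (hpos : ∀ r, 0 < ψ r)
    (μ : ℝ) (r : B) :
    derivR (fun r => ψ r ^ (1 - μ)) r = (1 - μ) * warpingSpeed ψ μ r := by
  rw [derivR_eq_deriv (contMDiff_rpow_const hψ hpos _)]
  have e : extendToReal (fun r => ψ r ^ (1 - μ)) =ᶠ[nhds (r : ℝ)]
      fun s => extendToReal ψ s ^ (1 - μ) := by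
    filter_upwards [B.isOpen.mem_nhds r.2] with s hs
    rw [show s = ((⟨s, hs⟩ : B) : ℝ) from rfl, extendToReal_coe, extendToReal_coe]
  have h0 := extendToReal_pos hpos r.2
  rw [e.deriv_eq, ((hasDerivAt_extendToReal hψ hpos μ r.2).rpow_const (Or.inl h0.ne')).deriv]
  rw [show 1 - μ - 1 = -μ by ring, Real.rpow_neg h0.le]
  have := (Real.rpow_pos_of_pos h0 μ).ne'
  field_simp

/-- For `v = ψ ^ (1 - μ)` one has `v' / (1 - μ) = W` and `v ^ (2 / (1 - μ)) = ψ ^ 2`; both need `μ ≠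
1`. -/
theorem warpedODE_iff (hψ : ContMDiff 𝓘(ℝ, ℝ) 𝓘(ℝ, ℝ) ∞ ψ) (hpos : ∀ r, 0 < ψ r)
    {μ : ℝ} (hμ : μ ≠ 1) (a e c ν : ℝ) (r : B) :
    a * (e * (derivR (fun r => ψ r ^ (1 - μ)) r ^ 2 / (1 - μ) ^ 2) +
        c * (ψ r ^ (1 - μ)) ^ (2 / (1 - μ))) = ν ↔
      a * (e * warpingSpeed ψ μ r ^ 2 + c * ψ r ^ 2) = ν := by
  have h1 : 1 - μ ≠ 0 := sub_ne_zero.mpr hμ.symm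
  rw [derivR_rpow_const hψ hpos, ← Real.rpow_mul (hpos r).le, mul_div_cancel₀ _ h1, Real.rpow_two,
    mul_pow, mul_div_cancel_left₀ _ (pow_ne_zero 2 h1)]

/-- A function with vanishing derivative on a connected open subset of the line is constant. -/
theorem eq_of_deriv_eq_zero (hB : IsConnected (B : Set ℝ)) {f : ℝ → ℝ}
    (hf : ∀ s ∈ B, HasDerivAt f 0 s) (r s : B) : f r = f s :=
  B.isOpen.is_const_of_deriv_eq_zero hB.isPreconnected
    (fun x hx => (hf x hx).differentiableAt.differentiableWithinAt)
    (fun x hx => (hf x hx).deriv) r.2 s.2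

/-- The derivative of the first integral `e W² + l ψ²`. -/
theorem hasDerivAt_firstIntegral (hψ : ContMDiff 𝓘(ℝ, ℝ) 𝓘(ℝ, ℝ) ∞ ψ) (hpos : ∀ r, 0 < ψ r)
    (μ e : ℝ) {l : ℝ → ℝ} {l' : ℝ} (r : B) (hl : HasDerivAt l l' r) :
    HasDerivAt (fun s => e * warpingSpeed ψ μ s ^ 2 + l s * extendToReal ψ s ^ 2)
      (2 * warpingSpeed ψ μ r * (e * deriv (warpingSpeed ψ μ) r + l r * ψ r * ψ r ^ μ) +
        l' * ψ r ^ 2) r := by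
  have h := (((hasDerivAt_warpingSpeed hψ hpos μ r.2).pow 2).const_mul e).add
    (hl.mul ((hasDerivAt_extendToReal hψ hpos μ r.2).pow 2))
  rw [extendToReal_coe] at h
  convert! h using 1
  simp [extendToReal_coe]
  ring

theorem eq_of_warpingSpeed_eq_zero (hψ : ContMDiff 𝓘(ℝ, ℝ) 𝓘(ℝ, ℝ) ∞ ψ) (hpos : ∀ r, 0 < ψ r)
    (hB : IsConnected (B : Set ℝ)) {μ : ℝ} (hW : ∀ s ∈ B, warpingSpeed ψ μ s = 0) (r s : B) :
    ψ r = ψ s := by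
  rw [← extendToReal_coe ψ r, ← extendToReal_coe ψ s]
  refine eq_of_deriv_eq_zero hB (fun t ht => ?_) r s
  have h := hasDerivAt_extendToReal hψ hpos μ ht
  rwa [hW t ht, mul_zero] at h

theorem warpingSpeed_eq_zero (hconst : ∀ r s, ψ r = ψ s) (μ : ℝ) {s : ℝ} (hs : s ∈ B) :
    warpingSpeed ψ μ s = 0 := by
  have e : extendToReal ψ =ᶠ[nhds s] fun _ => ψ ⟨s, hs⟩ := by
    filter_upwards [B.isOpen.mem_nhds hs] with t ht
    rw [show t = ((⟨t, ht⟩ : B) : ℝ) from rfl, extendToReal_coe]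
    exact hconst _ _
  rw [warpingSpeed, e.deriv_eq, deriv_const, mul_zero]

theorem deriv_eq_zero_of_eventually {f : ℝ → ℝ} {s : ℝ} (h : ∀ᶠ t in nhds s, f t = 0) :
    deriv f s = 0 := by
  have e : f =ᶠ[nhds s] fun _ => 0 := h
  rw [e.deriv_eq, deriv_const]

/-- A nonconstant solution of the first-order equation `e W² + m ψ² = d` satisfies the
second-order equation obtained by differentiating and cancelling `W`. -/
theorem secondOrder_of_firstOrder (hψ : ContMDiff 𝓘(ℝ, ℝ) 𝓘(ℝ, ℝ) ∞ ψ) (hpos : ∀ r, 0 < ψ r)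
    (hB : IsConnected (B : Set ℝ)) {μ e m d : ℝ} (hne : ∃ r s, ψ r ≠ ψ s)
    (h : ∀ r : B, e * warpingSpeed ψ μ r ^ 2 + m * ψ r ^ 2 = d) (r : B) :
    e * deriv (warpingSpeed ψ μ) r + m * ψ r * ψ r ^ μ = 0 := by
  let Q : ℝ → ℝ := fun s =>
    e * deriv (warpingSpeed ψ μ) s + m * extendToReal ψ s * extendToReal ψ s ^ μ
  have hQcoe : ∀ s : B, Q s = e * deriv (warpingSpeed ψ μ) s + m * ψ s * ψ s ^ μ := fun s => by
    simp only [Q, extendToReal_coe]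
  have hQcont : ∀ s ∈ B, ContinuousAt Q s := fun s hs => by
    have c1 := (contDiffAt_warpingSpeed hψ hpos μ hs).derivWithin (m := 0) (by norm_cast)
    have c2 := (contDiffAt_extendToReal hψ hs).continuousAt
    exact (c1.continuousAt.const_mul e).add ((c2.const_mul m).mul
      (c2.rpow_const (Or.inl (extendToReal_pos hpos hs).ne')))
  -- The first integral is constant and its derivative is `2 W Q`.
  have hWQ : ∀ s ∈ B, Q s ≠ 0 → warpingSpeed ψ μ s = 0 := fun s hs hQ => by
    have h1 := hasDerivAt_firstIntegral hψ hpos μ e (r := ⟨s, hs⟩) (hasDerivAt_const s m)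
    have e1 : (fun t => e * warpingSpeed ψ μ t ^ 2 + m * extendToReal ψ t ^ 2) =ᶠ[nhds s]
        fun _ => d := by
      filter_upwards [B.isOpen.mem_nhds hs] with t ht
      rw [show t = ((⟨t, ht⟩ : B) : ℝ) from rfl, extendToReal_coe]
      exact h _
    have h2 := h1.unique ((hasDerivAt_const s d).congr_of_eventuallyEq e1)
    rw [← hQcoe, zero_mul, add_zero] at h2
    have h3 := (mul_eq_zero.mp h2).resolve_right hQ
    simpa using h3
  by_contra hr
  rw [← hQcoe] at hr
  -- `Q ≠ 0` is an open condition, so `W` vanishes on a neighbourhood and its derivative vanishes at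
  -- `s` too.
  have hW' : ∀ s : B, Q s ≠ 0 → Q s = m * ψ s * ψ s ^ μ ∧ m * ψ s ^ 2 = d := fun s hs => by
    have hev : ∀ᶠ t in nhds (s : ℝ), warpingSpeed ψ μ t = 0 := by
      filter_upwards [B.isOpen.mem_nhds s.2, (hQcont s s.2).eventually_ne hs] with t ht hQt
      exact hWQ t ht hQt
    have hs' := h s
    rw [hev.self_of_nhds] at hs'
    rw [hQcoe, deriv_eq_zero_of_eventually hev]
    exact ⟨by ring, by linarith⟩
  -- Here `m ≠ 0`, so `m ψ² = d` and positivity fix the value of `ψ`, and with it that of `Q`.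
  have hconst : ∀ s : B, Q s ≠ 0 → Q s = Q r := fun s hs => by
    obtain ⟨q1, m1⟩ := hW' s hs
    obtain ⟨q2, m2⟩ := hW' r hr
    have hm : m ≠ 0 := by
      rintro rfl
      exact hr (by rw [q2]; ring)
    have hsq : ψ s ^ 2 = ψ r ^ 2 := mul_left_cancel₀ hm (m1.trans m2.symm)
    rw [q1, q2, (pow_left_inj₀ (hpos s).le (hpos r).le two_ne_zero).mp hsq]
  have hc : Continuous fun s : B => Q s := continuous_iff_continuousAt.mpr fun s =>
    (hQcont s s.2).comp continuous_subtype_val.continuousAt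
  have : PreconnectedSpace B := Subtype.preconnectedSpace hB.isPreconnected
  -- The left description is open and the right one closed. By connectedness `Q` vanishes nowhere,
  -- hence `W = 0` on all of `B` and `ψ` is constant.
  have hS : {s : B | Q s ≠ 0} = {s : B | Q s = Q r} :=
    Set.ext fun s => ⟨hconst s, fun hs => show Q s ≠ 0 by rwa [show Q s = Q r from hs]⟩
  have hclopen : IsClopen {s : B | Q s ≠ 0} :=
    ⟨hS ▸ isClosed_eq hc continuous_const, isOpen_ne_fun hc continuous_const⟩
  have huniv := hclopen.eq_univ ⟨r, hr⟩
  obtain ⟨a, b, hab⟩ := hne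
  refine hab (eq_of_warpingSpeed_eq_zero hψ hpos hB (μ := μ) (fun s hs => hWQ s hs ?_) a b)
  have hmem : (⟨s, hs⟩ : B) ∈ {s : B | Q s ≠ 0} := huniv ▸ Set.mem_univ _
  exact hmem

end ODE

/-! ### The three claims. -/

theorem mainTheorem9
    (k : ℕ) (hk : 2 ≤ k)
    (F : Type*) [TopologicalSpace F] [ChartedSpace (EuclideanSpace ℝ (Fin k)) F]
    [IsManifold (𝓡 k) ∞ F] [ConnectedSpace F]
    (gF : PseudoRiemannianMetric (𝓡 k) F) (ν : ℝ) (hF : gF.IsEinstein (fun _ => ν))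
    (B : TopologicalSpace.Opens ℝ) (hB : IsConnected (B : Set ℝ)) (ε : ℤˣ)
    (μ : ℝ) (hμ0 : μ ≠ 0) (hμ1 : μ ≠ 1) (hμk : μ ≠ k)
    (hμ_plus : μ ≠ k - √((k : ℝ) ^ 2 - k)) (hμ_minus : μ ≠ k + √((k : ℝ) ^ 2 - k))
    (ψ : B → ℝ) (hψ : ContMDiff 𝓘(ℝ, ℝ) 𝓘(ℝ, ℝ) ∞ ψ) (hpos : ∀ r, 0 < ψ r) :
    let g := bcwp (intervalMetric B ε) gF ψ hψ hpos μ
    let v : B → ℝ := fun r => ψ r ^ (1 - μ)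
    let SolvesODE : ℝ → Prop := fun c => ∀ r : B,
      ((k : ℝ) - 1) * (((ε : ℤ) : ℝ) * (derivR v r ^ 2 / (1 - μ) ^ 2) +
        c / k * v r ^ (2 / (1 - μ))) = ν
    (∀ lam : B × F → ℝ, g.IsEinstein lam → ∃ c : ℝ, (∀ p, lam p = c) ∧ SolvesODE c) ∧
    (∀ c : ℝ, (∃ r s, v r ≠ v s) → SolvesODE c → g.IsEinstein (fun _ => c)) ∧
    ((∀ r s, ψ r = ψ s) →
      ∀ lam : B × F → ℝ, g.IsEinstein lam ↔ (∀ p, lam p = 0) ∧ ν = 0) := by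
  intro g v SolvesODE
  have hk0 : 0 < k := by omega
  have hkR : (2 : ℝ) ≤ k := by exact_mod_cast hk
  have hk1 : (k : ℝ) - 1 ≠ 0 := by linarith
  have hkne : (k : ℝ) ≠ 0 := by linarith
  have hode : ∀ c, SolvesODE c ↔ ∀ r : B, ((k : ℝ) - 1) *
      (((ε : ℤ) : ℝ) * warpingSpeed ψ μ r ^ 2 + c / k * ψ r ^ 2) = ν := fun c =>
    forall_congr' fun r => warpedODE_iff hψ hpos hμ1 _ _ _ _ r
  have hE : ∀ lam : B × F → ℝ, g.IsEinstein lam ↔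
      ContMDiff (𝓘(ℝ, ℝ).prod (𝓡 k)) 𝓘(ℝ, ℝ) ∞ lam ∧ ∀ p : B × F,
      ((ε : ℤ) : ℝ) * deriv (warpingSpeed ψ μ) p.1 = -(lam p / k * ψ p.1 * ψ p.1 ^ μ) ∧
      ((k : ℝ) - 1) * (((ε : ℤ) : ℝ) * warpingSpeed ψ μ p.1 ^ 2 + lam p / k * ψ p.1 ^ 2) = ν :=
    fun lam => and_congr_right fun _ => forall_congr' fun p =>
      ricci_bcwp_eq_smul_iff hk0 hF p (lam p)
  obtain ⟨y₀⟩ : Nonempty F := inferInstance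
  obtain ⟨r₀⟩ : Nonempty B := hB.nonempty.to_subtype
  refine ⟨fun lam h => ?_, fun c hne h => ?_, fun hconst lam => ?_⟩
  · obtain ⟨hsmooth, heq⟩ := (hE lam).mp h
    have hl : ContMDiff 𝓘(ℝ, ℝ) 𝓘(ℝ, ℝ) ∞ (fun r : B => lam (r, y₀)) :=
      hsmooth.comp (contMDiff_id.prodMk contMDiff_const)
    -- In the second-order equation `lam` is the only quantity that could vary along the fibre, and
    -- its coefficient `ψ ψ^μ / k` is nonzero.
    have hfib : ∀ (r : B) (y : F), lam (r, y) = lam (r, y₀) := fun r y => by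
      have h1 := (heq (r, y)).1.symm.trans (heq (r, y₀)).1
      have hP := (hpos r).ne'
      have hPμ := (Real.rpow_pos_of_pos (hpos r) μ).ne'
      simpa [hP, hPμ, hkne] using h1
    have hder : ∀ s ∈ B, HasDerivAt (extendToReal fun r : B => lam (r, y₀)) 0 s := fun s hs => by
      have hd := ((contDiffAt_extendToReal hl hs).differentiableAt (by simp)).hasDerivAt
      have h1 := hasDerivAt_firstIntegral hψ hpos μ ((ε : ℤ) : ℝ) ⟨s, hs⟩ (hd.div_const (k : ℝ))
      have e1 : (fun t => ((ε : ℤ) : ℝ) * warpingSpeed ψ μ t ^ 2 +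
          extendToReal (fun r : B => lam (r, y₀)) t / k * extendToReal ψ t ^ 2) =ᶠ[nhds s]
          fun _ => ν / (k - 1) := by
        filter_upwards [B.isOpen.mem_nhds hs] with t ht
        rw [show t = ((⟨t, ht⟩ : B) : ℝ) from rfl, extendToReal_coe, extendToReal_coe,
          eq_div_iff hk1, mul_comm]
        exact (heq (⟨t, ht⟩, y₀)).2
      have h2 := h1.unique ((hasDerivAt_const s _).congr_of_eventuallyEq e1)
      have h3 := (heq (⟨s, hs⟩, y₀)).1
      have hlam := extendToReal_coe (fun r : B => lam (r, y₀)) ⟨s, hs⟩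
      simp only at h2 h3 hlam
      -- The second-order equation kills the term with factor `W`, so only `(λ' / k) ψ² = 0`
      -- remains.
      rw [h3, hlam, neg_add_cancel, mul_zero, zero_add] at h2
      have h4 := (mul_eq_zero.mp h2).resolve_right (pow_ne_zero 2 (hpos _).ne')
      rw [(div_eq_zero_iff.mp h4).resolve_right hkne] at hd
      exact hd
    have hc : ∀ r : B, lam (r, y₀) = lam (r₀, y₀) := fun r => by
      have h1 := eq_of_deriv_eq_zero hB hder r r₀
      rwa [extendToReal_coe, extendToReal_coe] at h1
    refine ⟨lam (r₀, y₀), fun p => (hfib p.1 p.2).trans (hc p.1), (hode _).mpr fun r => ?_⟩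
    rw [← hc r]
    exact (heq (r, y₀)).2
  · have h' := (hode c).mp h
    have hne' : ∃ r s, ψ r ≠ ψ s := by
      obtain ⟨r, s, hrs⟩ := hne
      exact ⟨r, s, fun h => hrs (congrArg (· ^ (1 - μ)) h)⟩
    have h2 := secondOrder_of_firstOrder hψ hpos hB (μ := μ) (e := ((ε : ℤ) : ℝ)) (m := c / k)
      (d := ν / (k - 1)) hne' fun r => by rw [eq_div_iff hk1, mul_comm]; exact h' r
    exact (hE _).mpr ⟨contMDiff_const, fun p => ⟨by linarith [h2 p.1], h' p.1⟩⟩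
  · have hW : ∀ r : B, warpingSpeed ψ μ r = 0 := fun r => warpingSpeed_eq_zero hconst μ r.2
    have hW' : ∀ r : B, deriv (warpingSpeed ψ μ) r = 0 := fun r => by
      refine deriv_eq_zero_of_eventually ?_
      filter_upwards [B.isOpen.mem_nhds r.2] with t ht using warpingSpeed_eq_zero hconst μ ht
    rw [hE]
    simp only [hW, hW']
    constructor
    · rintro ⟨-, h⟩
      have h0 : ∀ p, lam p = 0 := fun p => by
        have hP := (hpos p.1).ne'
        have hPμ := (Real.rpow_pos_of_pos (hpos p.1) μ).ne'
        -- Since `W' = 0`, the second-order equation reads `(λ / k) ψ ψ^μ = 0`.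
        simpa [hP, hPμ, hkne] using (h p).1
      refine ⟨h0, ?_⟩
      have h1 := (h (r₀, y₀)).2
      rw [h0] at h1
      simpa using h1.symm
    · rintro ⟨h0, rfl⟩
      obtain rfl : lam = fun _ => 0 := funext h0
      exact ⟨contMDiff_const, fun p => by simp⟩
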